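/- Throughout, algebraic geometry is over $\mathbb{C}$. An irreducible hypersurface of $\mathbb{C}^n$ is the zero set of a nonconstant polynomial in $\mathbb{C}[x_1,\ldots,x_n]$ that is irreducible in the Zariski topology; it is smooth if its Zariski tangent space has dimension $n-1$ at each of its points, and singular otherwise. Isomorphisms are isomorphisms of algebraic varieties, and automorphisms of $\mathbb{C}^n$ are polynomial maps with a polynomial inverse. Theorem. For every integer $n\geq 3$, there exist examples of (1) irreducible hypersurfaces $H_1,H_2\subset\mathbb{C}^n$ with isomorphic complements $\mathbb{C}^n\setminus H_1\simeq\mathbb{C}^n\setminus H_2$ such that $H_1$ and $H_2$ are smooth and nonisomorphic; (2) irreducible hypersurfaces $H_1,H_2\subset\mathbb{C}^n$ with isomorphic complements $\mathbb{C}^n\setminus H_1\simeq\mathbb{C}^n\setminus H_2$ such that $H_1$ is smooth but $H_2$ is singular; (3) irreducible hypersurfaces $H_1,H_2\subset\mathbb{C}^n$ with isomorphic complements $\mathbb{C}^n\setminus H_1\simeq\mathbb{C}^n\setminus H_2$ such that $H_1$ and $H_2$ are isomorphic, although there is no automorphism of $\mathbb{C}^n$ mapping $H_1$ onto $H_2$.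 -/

import Mathlib

/-- Regular functions on a subset `X` of `ℂⁿ` (meant for `X` locally closed, such as a hypersurface
or its complement): near each point of `X`, on a neighbourhood that is open in the Zariski topology
of `X`, the function is a quotient of two polynomials. -/
def IsRegularFunction {n : ℕ} (X : Set (Fin n → ℂ)) (φ : X → ℂ) : Prop :=
  ∀ p : X, ∃ g h : MvPolynomial (Fin n) ℂ, MvPolynomial.eval (p : Fin n → ℂ) h ≠ 0 ∧
    ∀ q : X, MvPolynomial.eval (q : Fin n → ℂ) h ≠ 0 →
      φ q = MvPolynomial.eval (q : Fin n → ℂ) g / MvPolynomial.eval (q : Fin n → ℂ) h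

/-- Morphisms of (quasi-affine) varieties: maps all of whose coordinates are regular functions. -/
def IsMorphism {n m : ℕ} {X : Set (Fin n → ℂ)} {Y : Set (Fin m → ℂ)} (φ : X → Y) : Prop :=
  ∀ i : Fin m, IsRegularFunction X (fun p => (φ p : Fin m → ℂ) i)

/-- Isomorphism of algebraic varieties: a bijection that is a morphism in both directions. -/
def IsomorphicVarieties {n m : ℕ} (X : Set (Fin n → ℂ)) (Y : Set (Fin m → ℂ)) : Prop :=
  ∃ e : X ≃ Y, IsMorphism (e : X → Y) ∧ IsMorphism (e.symm : Y → X)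

/-- Polynomial maps `ℂⁿ → ℂᵐ`. -/
def IsPolynomialMap {n m : ℕ} (φ : (Fin n → ℂ) → (Fin m → ℂ)) : Prop :=
  ∃ F : Fin m → MvPolynomial (Fin n) ℂ, ∀ p i, φ p i = MvPolynomial.eval p (F i)

/-- Algebraic automorphisms of `ℂⁿ`. -/
def IsAlgebraicAutomorphism {n : ℕ} (e : (Fin n → ℂ) ≃ (Fin n → ℂ)) : Prop :=
  IsPolynomialMap (e : (Fin n → ℂ) → (Fin n → ℂ)) ∧
    IsPolynomialMap (e.symm : (Fin n → ℂ) → (Fin n → ℂ))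

/-- Algebraic (that is, Zariski closed) subsets of `ℂⁿ`. -/
def IsAlgebraicSet {n : ℕ} (X : Set (Fin n → ℂ)) : Prop :=
  ∃ I : Ideal (MvPolynomial (Fin n) ℂ), X = MvPolynomial.zeroLocus ℂ I

/-- Irreducible for the Zariski topology. -/
def IsZariskiIrreducible {n : ℕ} (X : Set (Fin n → ℂ)) : Prop :=
  X.Nonempty ∧ ∀ A B : Set (Fin n → ℂ), IsAlgebraicSet A → IsAlgebraicSet B →
    X ⊆ A ∪ B → X ⊆ A ∨ X ⊆ B

/-- Irreducible hypersurfaces of `ℂⁿ`: irreducible zero sets of nonconstant polynomials. -/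
def IsIrreducibleHypersurface {n : ℕ} (H : Set (Fin n → ℂ)) : Prop :=
  (∃ f : MvPolynomial (Fin n) ℂ, (∀ c : ℂ, f ≠ MvPolynomial.C c) ∧
    H = {p | MvPolynomial.eval p f = 0}) ∧ IsZariskiIrreducible H

/-- The Zariski tangent space at `p` of an algebraic set `X` in `ℂⁿ`: the common kernel of the
differentials at `p` of all polynomials that vanish on `X`. -/
def zariskiTangentSpace {n : ℕ} (X : Set (Fin n → ℂ)) (p : Fin n → ℂ) :
    Submodule ℂ (Fin n → ℂ) where
  carrier := {v | ∀ f ∈ MvPolynomial.vanishingIdeal ℂ X,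
    ∑ i, MvPolynomial.eval p (MvPolynomial.pderiv i f) * v i = 0}
  zero_mem' := by
    intro f _
    simp
  add_mem' := by
    intro v w hv hw f hf
    simp only [Pi.add_apply, mul_add, Finset.sum_add_distrib, hv f hf, hw f hf, add_zero]
  smul_mem' := by
    intro c v hv f hf
    simp only [Pi.smul_apply, smul_eq_mul, mul_left_comm _ c, ← Finset.mul_sum, hv f hf, mul_zero]

/-- A hypersurface of `ℂⁿ` is smooth at `p` if its tangent space at `p` has dimension `n - 1`, the
dimension of the hypersurface. -/
def IsSmoothPoint {n : ℕ} (H : Set (Fin n → ℂ)) (p : Fin n → ℂ) : Prop :=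
  Module.finrank ℂ (zariskiTangentSpace H p) + 1 = n

/-- A hypersurface is smooth if it is smooth at each of its points. -/
def IsSmoothHypersurface {n : ℕ} (H : Set (Fin n → ℂ)) : Prop :=
  ∀ p ∈ H, IsSmoothPoint H p

/-- A hypersurface is singular if it has a point at which it is not smooth. -/
def IsSingularHypersurface {n : ℕ} (H : Set (Fin n → ℂ)) : Prop :=
  ∃ p ∈ H, ¬ IsSmoothPoint H p

/-!
The coordinates of `ℂⁿ`, `n = m + 3`, are `y = X 0`, `x = X 1`, `w = X 2` and further coordinates that
enter no equation.

All examples come from one principle. In a polynomial `f = x ^ k a + b`, write `t` for the value of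
`f` and substitute `x = t x'`. Where `t ≠ 0`, the equation `f = t` can be solved for `t` modulo a
power of `x'`, and it takes the form `f' = t` for a polynomial `f'` in `x'`, a new coordinate `y'` and
the remaining coordinates. So `t ≠ 0` is the complement of `f = 0` and of `f' = 0` at the same time,
while the hypersurfaces `f = 0` and `f' = 0` themselves may differ.

For polynomials `S`, `F` in `w` this turns `x² S y + F + x S` into `x² S y + F (1 + x S)`
(`isomorphicVarieties_compl_twisted_untwisted`). If `S` and `F` are coprime, the first hypersurface is
smooth, and the second is singular at the multiple roots of `F`.

* `S = 1`, `F = w²` gives a smooth hypersurface and a singular one.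
* `S = w`, `F = 1 - w` gives two smooth ones, on which `w` vanishes nowhere. Hence `w` is constant on
  every curve `𝔸¹ → H`. Such curves with `w = 1` and nonconstant `(x, y)` lie on `x = 0` for the
  first hypersurface, but on `x = 0` or on `y = 0` for the second, where the two meet. So the relation
  "being joined by a curve `𝔸¹ → H`" is transitive on the first hypersurface only
  (`not_isomorphicVarieties_twisted_untwisted`).

The same principle with `k = 3` turns `1 + x + x³ y` into `1 + x + x² + x³ y`. Both hypersurfaces are
graphs of functions `y` of `x ≠ 0`, hence isomorphic. An automorphism of `ℂⁿ` that maps one onto the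
other would match the equations up to a constant, and then also the reducible polynomials
`x (1 + x² y)` and `x (1 + x + x² y)`, factor by factor, which is impossible
(`not_exists_isAlgebraicAutomorphism_cubic`).

Irreducibility of all equations follows from Gauss's lemma, since they are linear in `y`, and the
Nullstellensatz then gives the ideals of the hypersurfaces.
-/

section

open MvPolynomial

/-! ### Coordinates and evaluation -/

lemma coord_one_ne_zero (m : ℕ) : (1 : Fin (m + 3)) ≠ 0 := by simp

lemma coord_two_ne_zero (m : ℕ) : (2 : Fin (m + 3)) ≠ 0 := by
  rw [← Fin.succ_one_eq_two]
  exact Fin.succ_ne_zero _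

lemma coord_two_ne_one (m : ℕ) : (2 : Fin (m + 3)) ≠ 1 := by
  rw [← Fin.succ_one_eq_two]
  intro h
  simpa using Fin.succ_injective _ (h.trans (Fin.succ_zero_eq_one).symm)

lemma eval_aeval_X {n : ℕ} (p : Fin n → ℂ) (i : Fin n) (S : Polynomial ℂ) :
    eval p (Polynomial.aeval (X i) S) = S.eval (p i) := by
  induction S using Polynomial.induction_on' with
  | add p q hp hq => simp [hp, hq]
  | monomial k c => simp [Polynomial.aeval_monomial, algebraMap_eq]

/-! ### Regular functions and morphisms -/

lemma isRegularFunction_eval {n : ℕ} (X : Set (Fin n → ℂ)) (g : MvPolynomial (Fin n) ℂ) :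
    IsRegularFunction X (fun p => eval (p : Fin n → ℂ) g) :=
  fun _ => ⟨g, 1, by simp, fun q _ => by simp⟩

lemma isRegularFunction_div {n : ℕ} {X : Set (Fin n → ℂ)} (g h : MvPolynomial (Fin n) ℂ)
    (hh : ∀ p ∈ X, eval p h ≠ 0) :
    IsRegularFunction X (fun p => eval (p : Fin n → ℂ) g / eval (p : Fin n → ℂ) h) :=
  fun p => ⟨g, h, hh p p.2, fun _ _ => rfl⟩

lemma IsRegularFunction.add {n : ℕ} {X : Set (Fin n → ℂ)} {φ ψ : X → ℂ}
    (hφ : IsRegularFunction X φ) (hψ : IsRegularFunction X ψ) :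
    IsRegularFunction X (fun p => φ p + ψ p) := by
  intro p
  obtain ⟨a, b, hb, h⟩ := hφ p
  obtain ⟨c, d, hd, h'⟩ := hψ p
  refine ⟨a * d + c * b, b * d, by simp [hb, hd], fun q hq => ?_⟩
  rw [map_mul, mul_ne_zero_iff] at hq
  simp only [h q hq.1, h' q hq.2]
  rw [div_add_div _ _ hq.1 hq.2]
  simp [mul_comm]

lemma IsRegularFunction.mul {n : ℕ} {X : Set (Fin n → ℂ)} {φ ψ : X → ℂ}
    (hφ : IsRegularFunction X φ) (hψ : IsRegularFunction X ψ) :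
    IsRegularFunction X (fun p => φ p * ψ p) := by
  intro p
  obtain ⟨a, b, hb, h⟩ := hφ p
  obtain ⟨c, d, hd, h'⟩ := hψ p
  refine ⟨a * c, b * d, by simp [hb, hd], fun q hq => ?_⟩
  rw [map_mul, mul_ne_zero_iff] at hq
  simp only [h q hq.1, h' q hq.2]
  rw [div_mul_div_comm]
  simp

lemma IsMorphism.isRegularFunction_eval_comp {n m : ℕ} {X : Set (Fin n → ℂ)} {Y : Set (Fin m → ℂ)}
    {φ : X → Y} (hφ : IsMorphism φ) (g : MvPolynomial (Fin m) ℂ) :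
    IsRegularFunction X (fun p => eval (φ p : Fin m → ℂ) g) := by
  induction g using MvPolynomial.induction_on with
  | C a => simpa using isRegularFunction_eval X (C a)
  | add p q hp hq => simpa using hp.add hq
  | mul_X p i hp => simpa using hp.mul (hφ i)

lemma IsRegularFunction.comp {n m : ℕ} {X : Set (Fin n → ℂ)} {Y : Set (Fin m → ℂ)}
    {ψ : Y → ℂ} (hψ : IsRegularFunction Y ψ) {φ : X → Y} (hφ : IsMorphism φ) :
    IsRegularFunction X (fun p => ψ (φ p)) := by
  intro p
  obtain ⟨g, h, hh, hgh⟩ := hψ (φ p)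
  obtain ⟨a, b, hb, hab⟩ := hφ.isRegularFunction_eval_comp g p
  obtain ⟨c, d, hd, hcd⟩ := hφ.isRegularFunction_eval_comp h p
  refine ⟨a * (d * d), b * (d * c), ?_, fun q hq => ?_⟩
  · have := hcd p hd
    have hc : eval (p : Fin n → ℂ) c ≠ 0 := by
      intro hc
      exact hh (by simpa [hc] using this)
    simp [hb, hc, hd]
  · simp only [map_mul, mul_ne_zero_iff] at hq
    obtain ⟨hqb, hqd, hqc⟩ := hq
    have h1 := hab q hqb
    have h2 := hcd q hqd
    simp only at h1 h2 ⊢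
    rw [hgh (φ q) (by rw [h2]; exact div_ne_zero hqc hqd), h1, h2]
    simp only [map_mul]
    field_simp

lemma IsMorphism.comp {n m k : ℕ} {X : Set (Fin n → ℂ)} {Y : Set (Fin m → ℂ)}
    {Z : Set (Fin k → ℂ)} {ψ : Y → Z} (hψ : IsMorphism ψ) {φ : X → Y} (hφ : IsMorphism φ) :
    IsMorphism (fun p => ψ (φ p)) :=
  fun i => (hψ i).comp hφ

/-- A regular function on the whole affine space is a polynomial: the polynomials `h` for which
`h • φ` is a polynomial function form an ideal, and this ideal has no zeros. -/
lemma IsRegularFunction.exists_eq_eval {n : ℕ} {φ : ↥(Set.univ : Set (Fin n → ℂ)) → ℂ}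
    (hφ : IsRegularFunction Set.univ φ) :
    ∃ g : MvPolynomial (Fin n) ℂ, ∀ p, φ p = eval (p : Fin n → ℂ) g := by
  let J : Ideal (MvPolynomial (Fin n) ℂ) :=
    { carrier := {h | ∃ g : MvPolynomial (Fin n) ℂ, ∀ p : ↥(Set.univ : Set (Fin n → ℂ)),
        eval (p : Fin n → ℂ) h * φ p = eval (p : Fin n → ℂ) g}
      zero_mem' := ⟨0, by simp⟩
      add_mem' := by
        rintro a b ⟨g, hg⟩ ⟨g', hg'⟩
        exact ⟨g + g', fun p => by rw [map_add, map_add, add_mul, hg, hg']⟩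
      smul_mem' := by
        rintro c a ⟨g, hg⟩
        exact ⟨c * g, fun p => by rw [smul_eq_mul, map_mul, map_mul, mul_assoc, hg]⟩ }
  have hJ : zeroLocus ℂ J = ∅ := by
    rw [Set.eq_empty_iff_forall_notMem]
    intro p hp
    obtain ⟨g, h, hh, hgh⟩ := hφ ⟨p, trivial⟩
    -- The square makes the identity hold also where `h` vanishes.
    have hmem : h ^ 2 ∈ J := by
      refine ⟨h * g, fun q => ?_⟩
      by_cases hq : eval (q : Fin n → ℂ) h = 0
      · simp [hq]
      · rw [hgh q hq]
        simp only [map_pow, map_mul]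
        field_simp
    have := hp _ hmem
    rw [aeval_eq_eval, map_pow] at this
    exact hh (pow_eq_zero_iff two_ne_zero |>.mp this)
  have htop : J.radical = ⊤ := by
    rw [← vanishingIdeal_zeroLocus_eq_radical (K := ℂ), hJ, vanishingIdeal_empty]
  obtain ⟨g, hg⟩ : (1 : MvPolynomial (Fin n) ℂ) ∈ J := by
    rw [← Ideal.eq_top_iff_one]
    exact Ideal.radical_eq_top.mp htop
  exact ⟨g, fun p => by simpa using hg p⟩

/-! ### Polynomial curves -/

/-- The two points of `X` are joined by a curve `𝔸¹ → X`. -/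
def JoinedByLine {n : ℕ} (X : Set (Fin n → ℂ)) (a b : X) : Prop :=
  ∃ γ : ↥(Set.univ : Set (Fin 1 → ℂ)) → X, IsMorphism γ ∧ a ∈ Set.range γ ∧ b ∈ Set.range γ

lemma JoinedByLine.map {n m : ℕ} {X : Set (Fin n → ℂ)} {Y : Set (Fin m → ℂ)} {φ : X → Y}
    (hφ : IsMorphism φ) {a b : X} (h : JoinedByLine X a b) : JoinedByLine Y (φ a) (φ b) := by
  obtain ⟨γ, hγ, ⟨s, rfl⟩, ⟨t, rfl⟩⟩ := h
  exact ⟨_, hφ.comp hγ, ⟨s, rfl⟩, ⟨t, rfl⟩⟩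

/-- A curve `𝔸¹ → X` is given by polynomials in one variable. -/
lemma joinedByLine_iff {n : ℕ} {X : Set (Fin n → ℂ)} {a b : X} :
    JoinedByLine X a b ↔ ∃ g : Fin n → Polynomial ℂ, (∀ s, (fun i => (g i).eval s) ∈ X) ∧
      (∃ s, ∀ i, (g i).eval s = (a : Fin n → ℂ) i) ∧
      (∃ s, ∀ i, (g i).eval s = (b : Fin n → ℂ) i) := by
  constructor
  · rintro ⟨γ, hγ, ⟨s, rfl⟩, ⟨t, rfl⟩⟩
    choose G hG using fun i => (hγ i).exists_eq_eval
    have key : ∀ (u : (Set.univ : Set (Fin 1 → ℂ))) (i : Fin n),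
        (aeval (fun _ => Polynomial.X) (G i) : Polynomial ℂ).eval ((u : Fin 1 → ℂ) 0)
          = (γ u : Fin n → ℂ) i := by
      intro u i
      rw [hG i u, ← Polynomial.coe_evalRingHom, ← RingHom.coe_coe (aeval _),
        ← RingHom.comp_apply]
      congr 1
      apply MvPolynomial.ringHom_ext
      · intro r; simp
      · intro j; simp [Subsingleton.elim j 0]
    refine ⟨fun i => aeval (fun _ => Polynomial.X) (G i), fun u => ?_, ⟨_, key s⟩, ⟨_, key t⟩⟩
    have := funext (key ⟨fun _ => u, trivial⟩)
    simp only at this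
    rw [this]
    exact (γ _).2
  · rintro ⟨g, hg, ⟨s, hs⟩, ⟨t, ht⟩⟩
    refine ⟨fun u => ⟨fun i => (g i).eval ((u : Fin 1 → ℂ) 0), hg _⟩, fun i => ?_,
      ⟨⟨fun _ => s, trivial⟩, Subtype.ext (funext hs)⟩,
      ⟨⟨fun _ => t, trivial⟩, Subtype.ext (funext ht)⟩⟩
    simpa only [eval_aeval_X] using isRegularFunction_eval (Set.univ : Set (Fin 1 → ℂ))
      (Polynomial.aeval (MvPolynomial.X (0 : Fin 1)) (g i))

lemma Polynomial.exists_eq_C_of_forall_eval_ne_zero {g : Polynomial ℂ}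
    (h : ∀ s, g.eval s ≠ 0) : ∃ c, g = Polynomial.C c := by
  refine ⟨_, Polynomial.eq_C_of_degree_le_zero (le_of_not_gt fun hd => ?_)⟩
  obtain ⟨s, hs⟩ := IsAlgClosed.exists_root g hd.ne'
  exact h s hs

/-! ### Hypersurfaces and their ideals -/

/-- The zero set of a polynomial. -/
def hypersurface {n : ℕ} (f : MvPolynomial (Fin n) ℂ) : Set (Fin n → ℂ) := {p | eval p f = 0}

lemma mem_hypersurface {n : ℕ} {f : MvPolynomial (Fin n) ℂ} {p : Fin n → ℂ} :
    p ∈ hypersurface f ↔ eval p f = 0 := Iff.rfl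

lemma vanishingIdeal_hypersurface {n : ℕ} {f : MvPolynomial (Fin n) ℂ} (hf : Irreducible f) :
    vanishingIdeal ℂ (hypersurface f) = Ideal.span {f} := by
  have : (Ideal.span {f}).IsPrime := (Ideal.span_singleton_prime hf.ne_zero).mpr hf.prime
  rw [← IsPrime.vanishingIdeal_zeroLocus (K := ℂ) (Ideal.span {f}), zeroLocus_span]
  simp [hypersurface, aeval_eq_eval]

lemma isIrreducibleHypersurface_hypersurface {n : ℕ} {f : MvPolynomial (Fin n) ℂ}
    (hf : Irreducible f) : IsIrreducibleHypersurface (hypersurface f) := by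
  have hv := vanishingIdeal_hypersurface hf
  have hp : (Ideal.span {f}).IsPrime := (Ideal.span_singleton_prime hf.ne_zero).mpr hf.prime
  refine ⟨⟨f, ?_, rfl⟩, ?_, ?_⟩
  · rintro c rfl
    by_cases hc : c = 0
    · exact hf.ne_zero (by simp [hc])
    · exact hf.not_isUnit ((IsUnit.mk0 c hc).map C)
  · rw [Set.nonempty_iff_ne_empty]
    intro h
    rw [h, vanishingIdeal_empty] at hv
    exact hp.ne_top hv.symm
  · rintro A B ⟨I, rfl⟩ ⟨J, rfl⟩ hAB
    have hle : I * J ≤ Ideal.span {f} := by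
      rw [← hv, Ideal.mul_le]
      intro r hr s hs x hx
      rcases hAB hx with h | h
      · rw [map_mul, h r hr, zero_mul]
      · rw [map_mul, h s hs, mul_zero]
    rw [le_zeroLocus_iff_le_vanishingIdeal,
      le_zeroLocus_iff_le_vanishingIdeal, hv]
    exact hp.mul_le.mp hle

/-- The Jacobian criterion for a hypersurface with an irreducible equation. -/
lemma isSmoothPoint_hypersurface_iff {n : ℕ} {f : MvPolynomial (Fin n) ℂ} (hf : Irreducible f)
    {p : Fin n → ℂ} (hp : p ∈ hypersurface f) :
    IsSmoothPoint (hypersurface f) p ↔ ∃ i, eval p (pderiv i f) ≠ 0 := by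
  let L : Module.Dual ℂ (Fin n → ℂ) :=
    Fintype.linearCombination ℂ (fun i => eval p (pderiv i f))
  have hL : zariskiTangentSpace (hypersurface f) p = LinearMap.ker L := by
    ext v
    simp only [zariskiTangentSpace, vanishingIdeal_hypersurface hf, Submodule.mem_mk,
      AddSubmonoid.mem_mk, AddSubsemigroup.mem_mk, Set.mem_ofPred_eq, LinearMap.mem_ker, L,
      Fintype.linearCombination_apply, smul_eq_mul]
    constructor
    · intro h
      rw [← h f (Ideal.mem_span_singleton_self f)]
      exact Finset.sum_congr rfl fun i _ => mul_comm _ _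
    · intro h g hg
      obtain ⟨q, rfl⟩ := Ideal.mem_span_singleton.mp hg
      have hp' : eval p f = 0 := hp
      have : ∀ i, eval p (pderiv i (f * q)) * v i
          = eval p q * (v i * eval p (pderiv i f)) := by
        intro i
        simp [Derivation.leibniz, hp']
        ring
      simp only [this, ← Finset.mul_sum, h, mul_zero]
  unfold IsSmoothPoint
  rw [hL]
  constructor
  · intro h
    by_contra! hz
    have hL0 : L = 0 := by
      ext i
      simp [L, hz]
    rw [hL0, LinearMap.ker_zero, finrank_top, Module.finrank_fin_fun] at h
    omega
  · rintro ⟨i, hi⟩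
    have hL0 : L ≠ 0 := by
      intro h
      apply hi
      simpa [L] using LinearMap.congr_fun h (Pi.single i 1)
    rw [Module.Dual.finrank_ker_add_one_of_ne_zero hL0, Module.finrank_fin_fun]

/-- A polynomial that is linear in the first variable, with relatively prime coefficients, is
irreducible. -/
lemma irreducible_rename_mul_X_add_rename {n : ℕ} {A B : MvPolynomial (Fin n) ℂ} (hA : A ≠ 0)
    (hAB : IsRelPrime A B) :
    Irreducible (rename Fin.succ A * X 0 + rename Fin.succ B) := by
  rw [← MulEquiv.irreducible_iff (finSuccEquiv ℂ n)]
  have h := Polynomial.irreducible_C_mul_X_add_C hA hAB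
  have hC : ∀ p : MvPolynomial (Fin n) ℂ,
      finSuccEquiv ℂ n (rename Fin.succ p) = Polynomial.C p := by
    intro p
    induction p using MvPolynomial.induction_on with
    | C a => simp [finSuccEquiv_apply]
    | add p q hp hq => simp [hp, hq]
    | mul_X p i hp => rw [map_mul, map_mul, hp, rename_X, finSuccEquiv_X_succ, Polynomial.C_mul]
  rwa [map_add, map_mul, hC, hC, finSuccEquiv_X_zero]

/-- A criterion for isomorphic complements: the isomorphism divides the coordinate `x = X 1` by the
value `t` of the equation, the inverse multiplies it by `t`, the coordinate `y = X 0` is transformed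
by `A` and by `A' / t ^ k`, and all other coordinates are kept. -/
lemma isomorphicVarieties_compl {m : ℕ} {f f' A A' : MvPolynomial (Fin (m + 3)) ℂ} (k : ℕ)
    (hf : ∀ p, eval p f ≠ 0 →
      eval (Function.update (Function.update p 1 (p 1 / eval p f)) 0 (eval p A)) f' = eval p f)
    (hA : ∀ p, eval p f ≠ 0 →
      eval (Function.update (Function.update p 1 (p 1 / eval p f)) 0 (eval p A)) A'
        = eval p f ^ k * p 0)
    (hf' : ∀ p, eval p f' ≠ 0 →
      eval (Function.update (Function.update p 1 (p 1 * eval p f')) 0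
        (eval p A' / eval p f' ^ k)) f = eval p f')
    (hA' : ∀ p, eval p f' ≠ 0 →
      eval (Function.update (Function.update p 1 (p 1 * eval p f')) 0
        (eval p A' / eval p f' ^ k)) A = p 0) :
    IsomorphicVarieties (hypersurface f)ᶜ (hypersurface f')ᶜ := by
  have h10 := coord_one_ne_zero m
  refine ⟨⟨fun p => ⟨Function.update (Function.update p 1 (p.1 1 / eval p.1 f)) 0 (eval p.1 A), ?_⟩,
    fun p => ⟨Function.update (Function.update p 1 (p.1 1 * eval p.1 f')) 0
      (eval p.1 A' / eval p.1 f' ^ k), ?_⟩, fun p => Subtype.ext ?_, fun p => Subtype.ext ?_⟩,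
    fun i => ?_, fun i => ?_⟩
  · rw [Set.mem_compl_iff, mem_hypersurface, hf p.1 p.2]
    exact p.2
  · rw [Set.mem_compl_iff, mem_hypersurface, hf' p.1 p.2]
    exact p.2
  · have hp : eval p.1 f ≠ 0 := p.2
    ext i
    simp only [hf p.1 hp, hA p.1 hp]
    by_cases h0 : i = 0
    · subst h0
      simp [hp]
    · by_cases h1 : i = 1
      · subst h1
        simp [hp, h10]
      · simp [h0, h1]
  · have hp : eval p.1 f' ≠ 0 := p.2
    ext i
    simp only [hf' p.1 hp, hA' p.1 hp]
    by_cases h0 : i = 0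
    · subst h0
      simp
    · by_cases h1 : i = 1
      · subst h1
        simp [hp, h10]
      · simp [h0, h1]
  · by_cases h0 : i = 0
    · subst h0
      simpa using isRegularFunction_eval (hypersurface f)ᶜ A
    · by_cases h1 : i = 1
      · subst h1
        simpa [h10] using isRegularFunction_div (X := (hypersurface f)ᶜ) (X 1) f (fun p hp => hp)
      · simpa [h0, h1] using isRegularFunction_eval (hypersurface f)ᶜ (X i)
  · by_cases h0 : i = 0
    · subst h0
      simpa using isRegularFunction_div (X := (hypersurface f')ᶜ) A' (f' ^ k)
        (fun p hp => by rw [map_pow]; exact pow_ne_zero k hp)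
    · by_cases h1 : i = 1
      · subst h1
        simpa [h10] using (isRegularFunction_eval (hypersurface f')ᶜ (X 1)).mul
          (isRegularFunction_eval _ f')
      · simpa [h0, h1] using isRegularFunction_eval (hypersurface f')ᶜ (X i)

/-! ### Two families of hypersurfaces with isomorphic complements -/

/-- The polynomial `x² S(w) y + F(w) + x S(w)`, where `y`, `x`, `w` are the first three
coordinates. -/
noncomputable def twistedEquation (m : ℕ) (S F : Polynomial ℂ) : MvPolynomial (Fin (m + 3)) ℂ :=
  X 1 ^ 2 * Polynomial.aeval (X 2) S * X 0 +
    (Polynomial.aeval (X 2) F + X 1 * Polynomial.aeval (X 2) S)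

/-- The polynomial `x² S(w) y + F(w) (1 + x S(w))`, where `y`, `x`, `w` are the first three
coordinates. -/
noncomputable def untwistedEquation (m : ℕ) (S F : Polynomial ℂ) : MvPolynomial (Fin (m + 3)) ℂ :=
  X 1 ^ 2 * Polynomial.aeval (X 2) S * X 0 +
    Polynomial.aeval (X 2) F * (1 + X 1 * Polynomial.aeval (X 2) S)

lemma eval_twistedEquation {m : ℕ} (S F : Polynomial ℂ) (p : Fin (m + 3) → ℂ) :
    eval p (twistedEquation m S F) =
      p 1 ^ 2 * S.eval (p 2) * p 0 + (F.eval (p 2) + p 1 * S.eval (p 2)) := by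
  simp [twistedEquation, eval_aeval_X]

lemma eval_untwistedEquation {m : ℕ} (S F : Polynomial ℂ) (p : Fin (m + 3) → ℂ) :
    eval p (untwistedEquation m S F) =
      p 1 ^ 2 * S.eval (p 2) * p 0 + F.eval (p 2) * (1 + p 1 * S.eval (p 2)) := by
  simp [untwistedEquation, eval_aeval_X]

lemma rename_succ_aeval_X {n : ℕ} (i : Fin n) (S : Polynomial ℂ) :
    rename Fin.succ (Polynomial.aeval (X i : MvPolynomial (Fin n) ℂ) S) =
      Polynomial.aeval (X i.succ) S := by
  rw [← Polynomial.aeval_algHom_apply, rename_X]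

lemma isCoprime_aeval_X {n : ℕ} (i : Fin n) {S F : Polynomial ℂ} (h : IsCoprime S F) :
    IsCoprime (Polynomial.aeval (X i : MvPolynomial (Fin n) ℂ) S) (Polynomial.aeval (X i) F) := by
  obtain ⟨a, b, hab⟩ := h
  refine ⟨Polynomial.aeval (X i) a, Polynomial.aeval (X i) b, ?_⟩
  rw [← map_mul, ← map_mul, ← map_add, hab, map_one]

/-- Here `B` is a polynomial in `x`, `w`, … that restricts to `F(w)` on the hyperplane `x = 0`. -/
lemma irreducible_sq_mul_add {m : ℕ} {S F : Polynomial ℂ} (hS : S ≠ 0) (hF : F ≠ 0)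
    {B : MvPolynomial (Fin (m + 2)) ℂ} (hSB : IsCoprime (Polynomial.aeval (X 1) S) B)
    (hB : aeval (Fin.cons 0 fun _ => Polynomial.X : Fin (m + 2) → Polynomial ℂ) B = F) :
    Irreducible (X 1 ^ 2 * Polynomial.aeval (X 2) S * X 0 + rename Fin.succ B :
      MvPolynomial (Fin (m + 3)) ℂ) := by
  have hS' : Polynomial.aeval (X 1 : MvPolynomial (Fin (m + 2)) ℂ) S ≠ 0 := by
    intro h
    apply hS
    have := congrArg (aeval (fun _ => Polynomial.X : Fin (m + 2) → Polynomial ℂ)) h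
    rwa [← Polynomial.aeval_algHom_apply, aeval_X, Polynomial.aeval_X_left_apply, map_zero] at this
  have hx : IsRelPrime (X 0 : MvPolynomial (Fin (m + 2)) ℂ) B := by
    rw [(X_prime (i := (0 : Fin (m + 2)))).irreducible.isRelPrime_iff_not_dvd]
    rintro ⟨q, rfl⟩
    apply hF
    rw [← hB, map_mul, aeval_X, Fin.cons_zero, zero_mul]
  have hx2 : IsRelPrime (X 0 ^ 2 : MvPolynomial (Fin (m + 2)) ℂ) B := hx.pow_left
  have hrel : IsRelPrime (X 0 ^ 2 * Polynomial.aeval (X 1) S : MvPolynomial (Fin (m + 2)) ℂ) B :=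
    IsRelPrime.mul_left hx2 hSB.isRelPrime
  have hne : (X 0 ^ 2 * Polynomial.aeval (X 1) S : MvPolynomial (Fin (m + 2)) ℂ) ≠ 0 :=
    mul_ne_zero (pow_ne_zero 2 (X_ne_zero _)) hS'
  have h := irreducible_rename_mul_X_add_rename hne hrel
  rw [map_mul, map_pow, rename_X, rename_succ_aeval_X, Fin.succ_one_eq_two,
    Fin.succ_zero_eq_one] at h
  exact h

lemma irreducible_twistedEquation (m : ℕ) {S F : Polynomial ℂ} (hS : S ≠ 0) (hF : F ≠ 0)
    (hSF : IsCoprime S F) : Irreducible (twistedEquation m S F) := by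
  have h := irreducible_sq_mul_add (m := m) hS hF
    (B := Polynomial.aeval (X 1) F + X 0 * Polynomial.aeval (X 1) S)
    ((isCoprime_aeval_X 1 hSF).add_mul_right_right (X 0))
    (by simp [← Polynomial.aeval_algHom_apply])
  rw [map_add, map_mul, rename_succ_aeval_X, rename_succ_aeval_X, rename_X,
    Fin.succ_one_eq_two, Fin.succ_zero_eq_one] at h
  exact h

lemma irreducible_untwistedEquation (m : ℕ) {S F : Polynomial ℂ} (hS : S ≠ 0) (hF : F ≠ 0)
    (hSF : IsCoprime S F) : Irreducible (untwistedEquation m S F) := by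
  have h := irreducible_sq_mul_add (m := m) hS hF
    (B := Polynomial.aeval (X 1) F * (1 + X 0 * Polynomial.aeval (X 1) S))
    (IsCoprime.mul_right
      (isCoprime_aeval_X 1 hSF)
      ⟨-X 0, 1, by ring⟩)
    (by simp [← Polynomial.aeval_algHom_apply])
  rw [map_mul, map_add, map_one, map_mul, rename_succ_aeval_X, rename_succ_aeval_X, rename_X,
    Fin.succ_one_eq_two, Fin.succ_zero_eq_one] at h
  exact h

/-- Substituting `x = t x'` in `x² S y + F + x S = t` and multiplying by the inverse `1 + x' S` of
`1 - x' S` modulo `x'²` gives `x'² S y' + F (1 + x' S) = t`. -/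
lemma isomorphicVarieties_compl_twisted_untwisted (m : ℕ) (S F : Polynomial ℂ) :
    IsomorphicVarieties (hypersurface (twistedEquation m S F))ᶜ
      (hypersurface (untwistedEquation m S F))ᶜ := by
  have h10 := coord_one_ne_zero m
  have h20 := coord_two_ne_zero m
  have h21 := coord_two_ne_one m
  refine isomorphicVarieties_compl 2
    (A := twistedEquation m S F * Polynomial.aeval (X 2) S + twistedEquation m S F ^ 2 * X 0
      + twistedEquation m S F * X 1 * Polynomial.aeval (X 2) S * X 0)
    (A' := X 0 * (1 - X 1 * Polynomial.aeval (X 2) S)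
      - Polynomial.aeval (X 2) F * Polynomial.aeval (X 2) S)
    ?_ ?_ ?_ ?_ <;> intro p hp
  all_goals
    simp only [eval_twistedEquation, eval_untwistedEquation, map_add, map_sub, map_mul, map_pow,
      map_one, eval_X, eval_aeval_X, Function.update_self, Function.update_of_ne h10,
      Function.update_of_ne h20, Function.update_of_ne h21] at hp ⊢
    generalize S.eval (p 2) = s at hp ⊢
    generalize F.eval (p 2) = f at hp ⊢
    generalize p 0 = y at hp ⊢
    generalize p 1 = x at hp ⊢
  · obtain ⟨t, ht⟩ : ∃ t, t = x ^ 2 * s * y + (f + x * s) := ⟨_, rfl⟩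
    rw [← ht] at hp ⊢
    field_simp
    rw [ht]
    ring
  · obtain ⟨t, ht⟩ : ∃ t, t = x ^ 2 * s * y + (f + x * s) := ⟨_, rfl⟩
    rw [← ht] at hp ⊢
    field_simp
    rw [ht]
    ring
  · obtain ⟨t, ht⟩ : ∃ t, t = x ^ 2 * s * y + f * (1 + x * s) := ⟨_, rfl⟩
    rw [← ht] at hp ⊢
    field_simp
    rw [ht]
    ring
  · obtain ⟨t, ht⟩ : ∃ t, t = x ^ 2 * s * y + f * (1 + x * s) := ⟨_, rfl⟩
    rw [← ht] at hp ⊢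
    have h1 : (x * t) ^ 2 * s * ((y * (1 - x * s) - f * s) / t ^ 2) + (f + x * t * s) = t := by
      field_simp
      rw [ht]
      ring
    rw [h1]
    field_simp
    rw [ht]
    ring

/-! ### Smoothness -/

lemma pderiv_aeval_X_of_ne {n : ℕ} {i j : Fin n} (h : j ≠ i) (S : Polynomial ℂ) :
    pderiv i (Polynomial.aeval (X j : MvPolynomial (Fin n) ℂ) S) = 0 := by
  rw [Derivation.map_aeval, pderiv_X_of_ne h, smul_zero]

lemma pderiv_aeval_X_self {n : ℕ} (i : Fin n) (S : Polynomial ℂ) :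
    pderiv i (Polynomial.aeval (X i : MvPolynomial (Fin n) ℂ) S)
      = Polynomial.aeval (X i) S.derivative := by
  rw [Derivation.map_aeval, pderiv_X_self, smul_eq_mul, mul_one]

lemma eval_ne_zero_of_isCoprime {S F : Polynomial ℂ} (hSF : IsCoprime S F) {w : ℂ}
    (hF : F.eval w = 0) : S.eval w ≠ 0 := by
  obtain ⟨a, b, hab⟩ := hSF
  intro hS
  simpa [hF, hS] using congrArg (Polynomial.eval w) hab

lemma isSmoothHypersurface_twisted (m : ℕ) {S F : Polynomial ℂ} (hS : S ≠ 0) (hF : F ≠ 0)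
    (hSF : IsCoprime S F) : IsSmoothHypersurface (hypersurface (twistedEquation m S F)) := by
  intro p hp
  rw [isSmoothPoint_hypersurface_iff (irreducible_twistedEquation m hS hF hSF) hp]
  rw [mem_hypersurface, eval_twistedEquation] at hp
  have hs : S.eval (p 2) ≠ 0 := by
    intro h
    rw [h] at hp
    exact eval_ne_zero_of_isCoprime hSF (by simpa using hp) h
  by_cases hx : p 1 = 0
  · refine ⟨1, ?_⟩
    simpa [twistedEquation, pderiv_aeval_X_of_ne (coord_two_ne_one m), eval_aeval_X, hx,
      pderiv_X_of_ne (coord_one_ne_zero m).symm, Derivation.leibniz_pow] using hs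
  · refine ⟨0, ?_⟩
    simp [twistedEquation, pderiv_aeval_X_of_ne (coord_two_ne_zero m), eval_aeval_X, hx, hs,
      pderiv_X_of_ne (coord_one_ne_zero m), Derivation.leibniz_pow]

lemma isSmoothHypersurface_untwisted (m : ℕ) {S F : Polynomial ℂ} (hS : S ≠ 0) (hF : F ≠ 0)
    (hSF : IsCoprime S F) (hF' : IsCoprime F.derivative F) :
    IsSmoothHypersurface (hypersurface (untwistedEquation m S F)) := by
  intro p hp
  rw [isSmoothPoint_hypersurface_iff (irreducible_untwistedEquation m hS hF hSF) hp]
  rw [mem_hypersurface, eval_untwistedEquation] at hp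
  by_cases hx : p 1 = 0
  · refine ⟨2, ?_⟩
    have hf : F.eval (p 2) = 0 := by simpa [hx] using hp
    simpa [untwistedEquation, pderiv_aeval_X_self, eval_aeval_X, hx, hf,
      pderiv_X_of_ne (coord_two_ne_one m).symm, pderiv_X_of_ne (coord_two_ne_zero m).symm,
      Derivation.leibniz_pow] using eval_ne_zero_of_isCoprime hF' hf
  · refine ⟨0, ?_⟩
    have hs : S.eval (p 2) ≠ 0 := by
      intro h
      rw [h] at hp
      exact eval_ne_zero_of_isCoprime hSF (by simpa using hp) h
    simp [untwistedEquation, pderiv_aeval_X_of_ne (coord_two_ne_zero m), eval_aeval_X, hx, hs,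
      pderiv_X_of_ne (coord_one_ne_zero m), Derivation.leibniz_pow]

lemma isSingularHypersurface_untwisted (m : ℕ) {S F : Polynomial ℂ} (hS : S ≠ 0) (hF : F ≠ 0)
    (hSF : IsCoprime S F) {w : ℂ} (hw : F.eval w = 0) (hw' : F.derivative.eval w = 0) :
    IsSingularHypersurface (hypersurface (untwistedEquation m S F)) := by
  have hp : Function.update (0 : Fin (m + 3) → ℂ) 2 w ∈
      hypersurface (untwistedEquation m S F) := by
    simp [mem_hypersurface, eval_untwistedEquation, hw, (coord_two_ne_one m).symm]
  refine ⟨_, hp, ?_⟩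
  rw [isSmoothPoint_hypersurface_iff (irreducible_untwistedEquation m hS hF hSF) hp]
  push Not
  intro i
  by_cases h2 : i = 2
  · subst h2
    simp [untwistedEquation, eval_aeval_X, hw, hw',
      pderiv_X_of_ne (coord_two_ne_one m).symm, pderiv_X_of_ne (coord_two_ne_zero m).symm,
      (coord_two_ne_one m).symm, (coord_two_ne_zero m).symm, Derivation.leibniz_pow]
  · simp [untwistedEquation, pderiv_aeval_X_of_ne (Ne.symm h2), eval_aeval_X, hw,
      (coord_two_ne_one m).symm, (coord_two_ne_zero m).symm, Derivation.leibniz_pow]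

/-! ### Curves on the two smooth hypersurfaces -/

lemma Polynomial.eq_zero_or_eq_zero_of_forall_eval_mul {g h : Polynomial ℂ}
    (H : ∀ s, g.eval s * h.eval s = 0) : g = 0 ∨ h = 0 := by
  rw [← mul_eq_zero]
  exact Polynomial.funext fun s => by simpa using H s

/-- On `x² w y + 1 - w + x w = 0` the function `w` has no zeros, hence is constant along curves
`𝔸¹ → X`; for `w ≠ 1` so is `x`, and `w = 1` cuts out the disjoint curves `x = 0` and `x y = -1`. -/
lemma joinedByLine_twisted_iff {m : ℕ}
    (a b : hypersurface (twistedEquation m Polynomial.X (1 - Polynomial.X))) :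
    JoinedByLine _ a b ↔ (a.1 0 = b.1 0 ∧ a.1 1 = b.1 1 ∧ a.1 2 = b.1 2) ∨
      (a.1 1 = 0 ∧ a.1 2 = 1 ∧ b.1 1 = 0 ∧ b.1 2 = 1) := by
  have hmem : ∀ p : Fin (m + 3) → ℂ,
      p ∈ hypersurface (twistedEquation m Polynomial.X (1 - Polynomial.X)) ↔
      p 1 ^ 2 * p 2 * p 0 + (1 - p 2 + p 1 * p 2) = 0 := fun p => by
    simp [mem_hypersurface, eval_twistedEquation]
  rw [joinedByLine_iff]
  constructor
  · rintro ⟨g, hg, ⟨s, hs⟩, ⟨t, ht⟩⟩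
    simp only [hmem] at hg
    simp only [← hs, ← ht]
    obtain ⟨w, hw⟩ := Polynomial.exists_eq_C_of_forall_eval_ne_zero (g := g 2) fun s h => by
      simpa [h] using hg s
    have hw0 : w ≠ 0 := by
      rintro rfl
      simpa [hw] using hg 0
    simp only [hw, Polynomial.eval_C, and_true] at hg ⊢
    -- Once `x` is a nonzero constant, so is `y`.
    have hconst : (∀ s, (g 1).eval s ≠ 0) → (g 0).eval s = (g 0).eval t ∧
        (g 1).eval s = (g 1).eval t := by
      intro hx
      obtain ⟨x, hx'⟩ := Polynomial.exists_eq_C_of_forall_eval_ne_zero hx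
      have hx0 : x ≠ 0 := by simpa [hx'] using hx 0
      simp only [hx', Polynomial.eval_C, and_true] at hg ⊢
      have : x ^ 2 * w ≠ 0 := mul_ne_zero (pow_ne_zero 2 hx0) hw0
      apply mul_left_cancel₀ this
      linear_combination hg s - hg t
    by_cases hw1 : w = 1
    · subst hw1
      rcases Polynomial.eq_zero_or_eq_zero_of_forall_eval_mul (g := g 1) (h := g 1 * g 0 + 1)
        (fun s => by
          simp only [Polynomial.eval_add, Polynomial.eval_mul, Polynomial.eval_one]
          linear_combination hg s) with h | h
      · right
        simp [h]
      · left
        refine hconst fun s hs => ?_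
        have := congrArg (Polynomial.eval s) h
        simp [hs] at this
    · left
      refine hconst fun s hs => hw1 ?_
      have := hg s
      rw [hs] at this
      linear_combination -this
  · intro h
    refine ⟨fun i => Polynomial.C (a.1 i) + Polynomial.X * Polynomial.C (b.1 i - a.1 i),
      fun s => ?_, ⟨0, by simp⟩, ⟨1, by simp⟩⟩
    have ha := (hmem _).mp a.2
    rw [hmem]
    rcases h with ⟨h0, h1, h2⟩ | ⟨h1, h2, h3, h4⟩
    · simpa [h0, h1, h2] using ha
    · simp [h1, h2, h3, h4]

/-- Being joined by a curve `𝔸¹ → X` is a transitive relation on one of the hypersurfaces; on the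
other one the lines `x = 0` and `y = 0` in `w = 1` meet, but no curve joins points on both of them
off their intersection. -/
lemma not_isomorphicVarieties_twisted_untwisted (m : ℕ) :
    ¬ IsomorphicVarieties (hypersurface (twistedEquation m Polynomial.X (1 - Polynomial.X)))
      (hypersurface (untwistedEquation m Polynomial.X (1 - Polynomial.X))) := by
  rintro ⟨e, he, he'⟩
  have h10 := coord_one_ne_zero m
  have h20 := coord_two_ne_zero m
  have h21 := coord_two_ne_one m
  have hmem : ∀ p : Fin (m + 3) → ℂ,
      p ∈ hypersurface (untwistedEquation m Polynomial.X (1 - Polynomial.X)) ↔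
      p 1 ^ 2 * p 2 * p 0 + (1 - p 2) * (1 + p 1 * p 2) = 0 := fun p => by
    simp [mem_hypersurface, eval_untwistedEquation]
  -- The point with `y = r`, `x = s`, `w = 1` and all other coordinates zero.
  let P : ℂ → ℂ → Fin (m + 3) → ℂ := fun r s =>
    Function.update (Function.update (Function.update 0 2 1) 1 s) 0 r
  have hP0 : ∀ r s, P r s 0 = r := fun r s => by simp [P]
  have hP1 : ∀ r s, P r s 1 = s := fun r s => by simp [P, h10]
  have hP2 : ∀ r s, P r s 2 = 1 := fun r s => by simp [P, h20, h21]
  have hP : ∀ r s, s ^ 2 * r = 0 →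
      P r s ∈ hypersurface (untwistedEquation m Polynomial.X (1 - Polynomial.X)) := by
    intro r s h
    rw [hmem, hP0, hP1, hP2]
    linear_combination h
  have hline : ∀ (r s : ℂ) (h : s ^ 2 * r = 0),
      JoinedByLine _ ⟨P r s, hP r s h⟩ ⟨P 0 0, hP 0 0 (by simp)⟩ := by
    intro r s h
    rw [joinedByLine_iff]
    refine ⟨fun i => Polynomial.C (P 0 0 i) + Polynomial.X * Polynomial.C (P r s i - P 0 0 i),
      fun u => ?_, ⟨1, by simp⟩, ⟨0, by simp⟩⟩
    rw [hmem]
    simp only [Polynomial.eval_add, Polynomial.eval_mul, Polynomial.eval_C, Polynomial.eval_X,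
      hP0, hP1, hP2]
    linear_combination u ^ 3 * h
  have h1 := (hline 1 0 (by simp)).map he'
  have h2 := (hline 0 1 (by simp)).map he'
  rw [joinedByLine_twisted_iff] at h1 h2
  have h3 : JoinedByLine _ (e.symm ⟨P 1 0, hP 1 0 (by simp)⟩) (e.symm ⟨P 0 1, hP 0 1 (by simp)⟩) := by
    rw [joinedByLine_twisted_iff]
    grind
  have h4 := h3.map he
  rw [e.apply_symm_apply, e.apply_symm_apply, joinedByLine_iff] at h4
  obtain ⟨g, hg, ⟨s, hs⟩, ⟨t, ht⟩⟩ := h4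
  simp only [hmem] at hg
  have hs0 := hs 0
  have hs2 := hs 2
  have ht1 := ht 1
  simp only [hP0, hP2, hP1] at hs0 hs2 ht1
  obtain ⟨w, hw⟩ := Polynomial.exists_eq_C_of_forall_eval_ne_zero (g := g 2) fun s h => by
    simpa [h] using hg s
  obtain rfl : w = 1 := by simpa [hw] using hs2
  rcases Polynomial.eq_zero_or_eq_zero_of_forall_eval_mul (g := g 1 ^ 2) (h := g 0) (fun s => by
    simpa [hw] using hg s) with h | h
  · rw [pow_eq_zero_iff two_ne_zero] at h
    simp [h] at ht1
  · simp [h] at hs0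

/-! ### Inequivalent embeddings of the same hypersurface -/

/-- The polynomial `1 + x + ε x² + x³ y`, where `y`, `x` are the first two coordinates. -/
noncomputable def cubicEquation (m : ℕ) (ε : ℂ) : MvPolynomial (Fin (m + 3)) ℂ :=
  X 1 ^ 3 * X 0 + (1 + X 1 + C ε * X 1 ^ 2)

lemma eval_cubicEquation {m : ℕ} (ε : ℂ) (p : Fin (m + 3) → ℂ) :
    eval p (cubicEquation m ε) = p 1 ^ 3 * p 0 + (1 + p 1 + ε * p 1 ^ 2) := by
  simp [cubicEquation]

lemma irreducible_pow_mul_add {m k : ℕ} {a b c d : ℂ} (ha : a ≠ 0) (hb : b ≠ 0) :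
    Irreducible (C a * X 1 ^ k * X 0 + (C b + C c * X 1 + C d * X 1 ^ 2) :
      MvPolynomial (Fin (m + 3)) ℂ) := by
  have hx : IsRelPrime (X 0 : MvPolynomial (Fin (m + 2)) ℂ) (C b + C c * X 0 + C d * X 0 ^ 2) := by
    rw [(X_prime (i := (0 : Fin (m + 2)))).irreducible.isRelPrime_iff_not_dvd]
    rintro ⟨q, hq⟩
    apply hb
    simpa using congrArg (eval 0) hq
  have hxk : IsRelPrime (X 0 ^ k : MvPolynomial (Fin (m + 2)) ℂ)
      (C b + C c * X 0 + C d * X 0 ^ 2) := hx.pow_left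
  have hau : IsUnit (C a : MvPolynomial (Fin (m + 2)) ℂ) := (IsUnit.mk0 a ha).map C
  have hrel : IsRelPrime (C a * X 0 ^ k : MvPolynomial (Fin (m + 2)) ℂ)
      (C b + C c * X 0 + C d * X 0 ^ 2) := IsRelPrime.mul_left hau.isRelPrime_left hxk
  have hne : (C a * X 0 ^ k : MvPolynomial (Fin (m + 2)) ℂ) ≠ 0 :=
    mul_ne_zero hau.ne_zero (pow_ne_zero k (X_ne_zero _))
  have h := irreducible_rename_mul_X_add_rename hne hrel
  simp only [map_mul, map_add, map_pow, rename_C, rename_X, Fin.succ_zero_eq_one] at h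
  exact h

lemma irreducible_cubicEquation (m : ℕ) (ε : ℂ) : Irreducible (cubicEquation m ε) := by
  simpa [cubicEquation] using
    irreducible_pow_mul_add (m := m) (k := 3) (c := 1) (d := ε) one_ne_zero one_ne_zero

/-- Substituting `x = t x'` in `1 + x + x³ y = t` and multiplying by the inverse `1 + x' + x'²` of
`1 - x'` modulo `x'³` gives `1 + x' + x'² + x'³ y' = t`. -/
lemma isomorphicVarieties_compl_cubic (m : ℕ) :
    IsomorphicVarieties (hypersurface (cubicEquation m 0))ᶜ
      (hypersurface (cubicEquation m 1))ᶜ := by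
  have h10 := coord_one_ne_zero m
  refine isomorphicVarieties_compl 3
    (A := cubicEquation m 0 + cubicEquation m 0 ^ 3 * X 0 + cubicEquation m 0 ^ 2 * X 1 * X 0
      + cubicEquation m 0 * X 1 ^ 2 * X 0)
    (A' := X 0 * (1 - X 1) - 1) ?_ ?_ ?_ ?_ <;> intro p hp
  all_goals
    simp only [eval_cubicEquation, map_add, map_sub, map_mul, map_pow,
      map_one, eval_X, Function.update_self, Function.update_of_ne h10, zero_mul, add_zero,
      one_mul] at hp ⊢
    generalize p 0 = y at hp ⊢
    generalize p 1 = x at hp ⊢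
  · obtain ⟨t, ht⟩ : ∃ t, t = x ^ 3 * y + (1 + x) := ⟨_, rfl⟩
    rw [← ht] at hp ⊢
    field_simp
    rw [ht]
    ring
  · obtain ⟨t, ht⟩ : ∃ t, t = x ^ 3 * y + (1 + x) := ⟨_, rfl⟩
    rw [← ht] at hp ⊢
    field_simp
    rw [ht]
    ring
  · obtain ⟨t, ht⟩ : ∃ t, t = x ^ 3 * y + (1 + x + x ^ 2) := ⟨_, rfl⟩
    rw [← ht] at hp ⊢
    field_simp
    rw [ht]
    ring
  · obtain ⟨t, ht⟩ : ∃ t, t = x ^ 3 * y + (1 + x + x ^ 2) := ⟨_, rfl⟩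
    rw [← ht] at hp ⊢
    have h1 : (x * t) ^ 3 * ((y * (1 - x) - 1) / t ^ 3) + (1 + x * t) = t := by
      field_simp
      rw [ht]
      ring
    rw [h1]
    field_simp
    rw [ht]
    ring

/-- The map `y ↦ y - 1 / x` is an isomorphism; `1 / x` is the polynomial `-(1 + x² y)` on the first
hypersurface and `-(1 + x + x² y)` on the second. -/
lemma isomorphicVarieties_cubic (m : ℕ) :
    IsomorphicVarieties (hypersurface (cubicEquation m 0)) (hypersurface (cubicEquation m 1)) := by
  have h10 := coord_one_ne_zero m
  refine ⟨⟨fun p => ⟨Function.update p 0 (p.1 0 + 1 + p.1 1 ^ 2 * p.1 0), ?_⟩,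
    fun p => ⟨Function.update p 0 (p.1 0 - (1 + p.1 1 + p.1 1 ^ 2 * p.1 0)), ?_⟩,
    fun p => Subtype.ext ?_, fun p => Subtype.ext ?_⟩, fun i => ?_, fun i => ?_⟩
  · have hp := p.2
    simp only [mem_hypersurface, eval_cubicEquation, Function.update_self,
      Function.update_of_ne h10] at hp ⊢
    linear_combination (1 + p.1 1 ^ 2) * hp
  · have hp := p.2
    simp only [mem_hypersurface, eval_cubicEquation, Function.update_self,
      Function.update_of_ne h10] at hp ⊢
    linear_combination (1 - p.1 1 ^ 2) * hp
  · have hp := p.2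
    simp only [mem_hypersurface, eval_cubicEquation] at hp
    ext i
    by_cases h0 : i = 0
    · subst h0
      simp only [Function.update_self, Function.update_of_ne h10]
      linear_combination -p.1 1 * hp
    · simp [h0]
  · have hp := p.2
    simp only [mem_hypersurface, eval_cubicEquation] at hp
    ext i
    by_cases h0 : i = 0
    · subst h0
      simp only [Function.update_self, Function.update_of_ne h10]
      linear_combination -p.1 1 * hp
    · simp [h0]
  · by_cases h0 : i = 0
    · subst h0
      convert isRegularFunction_eval (hypersurface (cubicEquation m 0))
        (X 0 + 1 + X 1 ^ 2 * X 0) using 2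
      simp
    · simpa [h0] using isRegularFunction_eval (hypersurface (cubicEquation m 0)) (X i)
  · by_cases h0 : i = 0
    · subst h0
      convert isRegularFunction_eval (hypersurface (cubicEquation m 1))
        (X 0 - (1 + X 1 + X 1 ^ 2 * X 0)) using 2
      simp
    · simpa [h0] using isRegularFunction_eval (hypersurface (cubicEquation m 1)) (X i)

lemma eval_aeval {n m : ℕ} (F : Fin m → MvPolynomial (Fin n) ℂ) (f : MvPolynomial (Fin m) ℂ)
    (p : Fin n → ℂ) : eval p (aeval F f) = eval (fun i => eval p (F i)) f := by
  induction f using MvPolynomial.induction_on with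
  | C a => simp
  | add f g hf hg => rw [map_add, map_add, map_add, hf, hg]
  | mul_X f i hf => rw [map_mul, map_mul, map_mul, hf, aeval_X, eval_X]

/-- An algebraic automorphism `e` of affine space comes from an automorphism of the polynomial
ring. -/
lemma IsAlgebraicAutomorphism.exists_algEquiv {n : ℕ} {e : (Fin n → ℂ) ≃ (Fin n → ℂ)}
    (he : IsAlgebraicAutomorphism e) :
    ∃ φ : MvPolynomial (Fin n) ℂ ≃ₐ[ℂ] MvPolynomial (Fin n) ℂ,
      ∀ f p, eval p (φ f) = eval (e p) f := by
  obtain ⟨⟨F, hF⟩, ⟨G, hG⟩⟩ := he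
  have hF' : ∀ f p, eval p (aeval F f) = eval (e p) f := by
    intro f p
    rw [eval_aeval, funext (hF p)]
  have hG' : ∀ f p, eval p (aeval G f) = eval (e.symm p) f := by
    intro f p
    rw [eval_aeval, funext (hG p)]
  refine ⟨AlgEquiv.ofAlgHom (aeval F) (aeval G) ?_ ?_, hF'⟩
  · ext1 i
    refine MvPolynomial.funext fun p => ?_
    rw [AlgHom.comp_apply, hF', hG', Equiv.symm_apply_apply, AlgHom.id_apply]
  · ext1 i
    refine MvPolynomial.funext fun p => ?_
    rw [AlgHom.comp_apply, hG', hF', Equiv.apply_symm_apply, AlgHom.id_apply]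

/-- An automorphism that maps one irreducible hypersurface onto another matches their equations up
to a constant. -/
lemma IsAlgebraicAutomorphism.exists_algEquiv_eq {n : ℕ} {e : (Fin n → ℂ) ≃ (Fin n → ℂ)}
    (he : IsAlgebraicAutomorphism e) {f f' : MvPolynomial (Fin n) ℂ} (hf : Irreducible f)
    (hf' : Irreducible f') (h : e '' hypersurface f = hypersurface f') :
    ∃ (φ : MvPolynomial (Fin n) ℂ ≃ₐ[ℂ] MvPolynomial (Fin n) ℂ) (c : ℂ),
      c ≠ 0 ∧ φ f' = C c * f := by
  obtain ⟨φ, hφ⟩ := he.exists_algEquiv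
  have hirr : Irreducible (φ f') := (MulEquiv.irreducible_iff φ).mpr hf'
  have hset : hypersurface (φ f') = hypersurface f := by
    ext p
    rw [mem_hypersurface, hφ, ← mem_hypersurface, ← h, e.injective.mem_set_image]
  have hspan : Ideal.span {f} = Ideal.span {φ f'} := by
    rw [← vanishingIdeal_hypersurface hf, ← vanishingIdeal_hypersurface hirr, hset]
  obtain ⟨u, hu⟩ := Ideal.span_singleton_eq_span_singleton.mp hspan
  obtain ⟨c, hc, hcu⟩ := isUnit_iff_eq_C_of_isReduced.mp u.isUnit
  exact ⟨φ, c, hc.ne_zero, by rw [← hu, hcu, mul_comm]⟩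

/-- An automorphism `φ` with `φ (1 + x + x² + x³ y) = c (1 + x + x³ y)` has `c = 1`, since only then
is `c (1 + x + x³ y) - 1` reducible. So it maps the factors `x` and `1 + x + x² y` of
`x + x² + x³ y` to the factors `x` and `1 + x² y` of `x + x³ y`, in some order. -/
lemma not_exists_isAlgebraicAutomorphism_cubic (m : ℕ) :
    ¬ ∃ e : (Fin (m + 3) → ℂ) ≃ (Fin (m + 3) → ℂ), IsAlgebraicAutomorphism e ∧
      e '' hypersurface (cubicEquation m 0) = hypersurface (cubicEquation m 1) := by
  rintro ⟨e, he, h⟩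
  have h10 := coord_one_ne_zero m
  obtain ⟨φ, c, hc, hφ⟩ := he.exists_algEquiv_eq (irreducible_cubicEquation m 0)
    (irreducible_cubicEquation m 1) h
  have hX : Irreducible (φ (X 1)) := (MulEquiv.irreducible_iff φ).mpr X_prime.irreducible
  have hnu : ¬ IsUnit (φ (1 + X 1 + X 1 ^ 2 * X 0)) := by
    rw [MulEquiv.isUnit_map φ]
    intro hu
    have := hu.map (eval (Function.update (Function.update 0 1 (-1)) 0 0))
    simp [h10] at this
  have hfac : φ (X 1) * φ (1 + X 1 + X 1 ^ 2 * X 0) =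
      C c * X 1 ^ 3 * X 0 + (C (c - 1) + C c * X 1 + C 0 * X 1 ^ 2) := by
    have h1 : (X 1 * (1 + X 1 + X 1 ^ 2 * X 0) : MvPolynomial (Fin (m + 3)) ℂ) =
        cubicEquation m 1 - 1 := by
      simp only [cubicEquation, C_1]
      ring
    rw [← map_mul, h1, map_sub, hφ, map_one]
    simp only [cubicEquation, C_0, C_sub, C_1]
    ring
  obtain rfl : c = 1 := by
    by_contra hc1
    have hirr := irreducible_pow_mul_add (m := m) (k := 3) (c := c) (d := 0) hc (sub_ne_zero.mpr hc1)
    rw [← hfac] at hirr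
    rcases hirr.isUnit_or_isUnit rfl with h | h
    · exact hX.not_isUnit h
    · exact hnu h
  have hfac' : φ (X 1) * φ (1 + X 1 + X 1 ^ 2 * X 0) = X 1 * (1 + X 1 ^ 2 * X 0) := by
    rw [hfac]
    simp only [sub_self, C_0, C_1]
    ring
  have hexp : φ (1 + X 1 + X 1 ^ 2 * X 0) = 1 + φ (X 1) + φ (X 1) ^ 2 * φ (X 0) := by
    simp only [map_add, map_mul, map_pow, map_one]
  have hXp : Prime (X 1 : MvPolynomial (Fin (m + 3)) ℂ) := X_prime
  rcases hXp.dvd_or_dvd (Dvd.intro _ hfac'.symm) with hd | hd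
  · -- `φ x = l x`: compare both sides modulo `x` and then modulo `x²`.
    obtain ⟨u, hu⟩ := hXp.irreducible.associated_of_dvd hX hd
    obtain ⟨l, -, hl⟩ := isUnit_iff_eq_C_of_isReduced.mp u.isUnit
    rw [hl] at hu
    have h1 : C l * φ (1 + X 1 + X 1 ^ 2 * X 0) = 1 + X 1 ^ 2 * X 0 := by
      apply mul_left_cancel₀ hXp.ne_zero
      rw [← hfac', ← hu]
      ring
    rw [hexp, ← hu] at h1
    obtain rfl : l = 1 := by simpa using congrArg (eval 0) h1
    have h2 : (1 + X 1 * φ (X 0) : MvPolynomial (Fin (m + 3)) ℂ) = X 1 * X 0 := by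
      apply mul_left_cancel₀ hXp.ne_zero
      rw [C_1] at h1
      linear_combination h1
    simpa using congrArg (eval 0) h2
  · -- `φ (1 + x + x² y) = l x` and `l φ x = 1 + x² y` for a constant `l`. Then `1 + x² y` divides
    -- `l x - 1 = φ (x + x² y)`.
    obtain ⟨q, hq⟩ := hd
    have h1 : φ (X 1) * q = 1 + X 1 ^ 2 * X 0 := by
      apply mul_left_cancel₀ hXp.ne_zero
      rw [← hfac', hq]
      ring
    have hirr : Irreducible (1 + X 1 ^ 2 * X 0 : MvPolynomial (Fin (m + 3)) ℂ) := by
      simpa [add_comm] using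
        irreducible_pow_mul_add (m := m) (k := 2) (c := 0) (d := 0) one_ne_zero one_ne_zero
    rw [← h1] at hirr
    have hqu := (hirr.isUnit_or_isUnit rfl).resolve_left hX.not_isUnit
    obtain ⟨l, hl, rfl⟩ := isUnit_iff_eq_C_of_isReduced.mp hqu
    have h2 : X 1 * C l - 1 = φ (X 1) * φ (1 + X 1 * X 0) := by
      have h3 : (1 + X 1 + X 1 ^ 2 * X 0 : MvPolynomial (Fin (m + 3)) ℂ) =
          1 + X 1 * (1 + X 1 * X 0) := by ring
      rw [← hq, h3, map_add, map_mul φ (X 1), map_one, add_sub_cancel_left]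
    -- The point `x = 2 / l`, `y = -1 / x²` is a zero of `1 + x² y = l φ x`, where `l x - 1 = 1`.
    have hl0 := hl.ne_zero
    have e1 := congrArg (eval (Function.update (Function.update (0 : Fin (m + 3) → ℂ) 1 (2 / l)) 0
      (-(l / 2) ^ 2))) h1
    have e2 := congrArg (eval (Function.update (Function.update (0 : Fin (m + 3) → ℂ) 1 (2 / l)) 0
      (-(l / 2) ^ 2))) h2
    simp only [map_mul, map_sub, map_add, map_one, map_pow, eval_X, eval_C, Function.update_self,
      Function.update_of_ne h10] at e1 e2
    have e3 : 1 + (2 / l) ^ 2 * (-(l / 2) ^ 2) = 0 := by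
      field_simp
      ring
    rw [e3, mul_eq_zero, or_iff_left hl0] at e1
    rw [e1, div_mul_cancel₀ _ hl0, zero_mul] at e2
    norm_num at e2

end

theorem theorem1 (n : ℕ) (hn : 3 ≤ n) :
    (∃ H₁ H₂ : Set (Fin n → ℂ), IsIrreducibleHypersurface H₁ ∧ IsIrreducibleHypersurface H₂ ∧
      IsomorphicVarieties H₁ᶜ H₂ᶜ ∧
      IsSmoothHypersurface H₁ ∧ IsSmoothHypersurface H₂ ∧ ¬ IsomorphicVarieties H₁ H₂) ∧
    (∃ H₁ H₂ : Set (Fin n → ℂ), IsIrreducibleHypersurface H₁ ∧ IsIrreducibleHypersurface H₂ ∧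
      IsomorphicVarieties H₁ᶜ H₂ᶜ ∧
      IsSmoothHypersurface H₁ ∧ IsSingularHypersurface H₂) ∧
    (∃ H₁ H₂ : Set (Fin n → ℂ), IsIrreducibleHypersurface H₁ ∧ IsIrreducibleHypersurface H₂ ∧
      IsomorphicVarieties H₁ᶜ H₂ᶜ ∧
      IsomorphicVarieties H₁ H₂ ∧
      ¬ ∃ e : (Fin n → ℂ) ≃ (Fin n → ℂ), IsAlgebraicAutomorphism e ∧ e '' H₁ = H₂) := by
  obtain ⟨m, rfl⟩ := Nat.exists_eq_add_of_le' hn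
  refine ⟨?_, ?_, ?_⟩
  · have hF0 : (1 - Polynomial.X : Polynomial ℂ) ≠ 0 := fun h => by
      simpa using congrArg (Polynomial.eval 0) h
    have hSF : IsCoprime Polynomial.X (1 - Polynomial.X : Polynomial ℂ) := ⟨1, 1, by ring⟩
    have hF' : IsCoprime (1 - Polynomial.X : Polynomial ℂ).derivative (1 - Polynomial.X) :=
      ⟨-1, 0, by simp⟩
    exact ⟨_, _,
      isIrreducibleHypersurface_hypersurface
        (irreducible_twistedEquation m Polynomial.X_ne_zero hF0 hSF),
      isIrreducibleHypersurface_hypersurface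
        (irreducible_untwistedEquation m Polynomial.X_ne_zero hF0 hSF),
      isomorphicVarieties_compl_twisted_untwisted m _ _,
      isSmoothHypersurface_twisted m Polynomial.X_ne_zero hF0 hSF,
      isSmoothHypersurface_untwisted m Polynomial.X_ne_zero hF0 hSF hF',
      not_isomorphicVarieties_twisted_untwisted m⟩
  · have hF0 : (Polynomial.X ^ 2 : Polynomial ℂ) ≠ 0 := pow_ne_zero 2 Polynomial.X_ne_zero
    have hSF : IsCoprime 1 (Polynomial.X ^ 2 : Polynomial ℂ) := isCoprime_one_left
    exact ⟨_, _,
      isIrreducibleHypersurface_hypersurface (irreducible_twistedEquation m one_ne_zero hF0 hSF),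
      isIrreducibleHypersurface_hypersurface (irreducible_untwistedEquation m one_ne_zero hF0 hSF),
      isomorphicVarieties_compl_twisted_untwisted m _ _,
      isSmoothHypersurface_twisted m one_ne_zero hF0 hSF,
      isSingularHypersurface_untwisted m one_ne_zero hF0 hSF (w := 0) (by simp) (by simp)⟩
  · exact ⟨_, _,
      isIrreducibleHypersurface_hypersurface (irreducible_cubicEquation m 0),
      isIrreducibleHypersurface_hypersurface (irreducible_cubicEquation m 1),
      isomorphicVarieties_compl_cubic m,
      isomorphicVarieties_cubic m,
      not_exists_isAlgebraicAutomorphism_cubic m⟩
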